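/- **Conventions.** Let $\mathcal N=\omega^\omega$. For a finite sequence $u=(u_0,\dots,u_{n-1})$ of naturals put $\langle u\rangle=p_0^{u_0+1}\cdots p_{n-1}^{u_{n-1}+1}$ ($p_0=2,p_1=3,\dots$ the primes, $\langle\emptyset\rangle=1$). If $s=\langle u\rangle$ and $i<n$ then $(s)_i=u_i$; in all other cases $(s)_i=0$. Put $q_s=(s)_0/((s)_1+1)$, and for $\beta\in\mathcal N$ put $(\beta)_n(i)=\beta(\langle n,i\rangle)$. A recursive Polish space $\mathcal X$ is a complete metric space $(\mathcal X,d)$ given with a dense sequence $(r_i)_{i\in\omega}$ such that the relations $d(r_i,r_j)<q_k$ and $d(r_i,r_j)\le q_k$ on $\omega^3$ are recursive. Its basic neighborhoods are the open balls $N(\mathcal X,s)=B(r_{(s)_0},q_{(s)_1})$. A product $\mathcal X\times\mathcal Y$ carries the maximum metric and the sequence $s\mapsto(r^{\mathcal X}_{(s)_0},r^{\mathcal Y}_{(s)_1})$. The space $\omega$ carries $|m-n|$ and $r_i=i$; the space $\mathcal N$ carries $d(\alpha,\beta)=2^{-\min\{n:\alpha(n)\ne\beta(n)\}}$ for $\alpha\neq\beta$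 and $r_s=((s)_0,(s)_1,(s)_2,\dots)$. For $\alpha\in\mathcal N$ let $$\mathrm F^{\mathcal X}(\alpha)=\mathcal X\setminus\bigcup_n N(\mathcal X,\alpha(n)),\qquad \mathrm G_1^{\mathcal X}(\alpha)=\{x:(\exists\gamma\in\mathcal N)\ (x,\gamma)\in \mathrm F^{\mathcal X\times\mathcal N}(\alpha)\}.$$ A subset of $\mathcal X$ is $\Sigma^0_1$ if it is $\bigcup_n N(\mathcal X,\varepsilon(n))$ for some recursive $\varepsilon:\omega\to\omega$; it is $\Pi^0_1$ if its complement is $\Sigma^0_1$; it is $\Sigma^1_1$ if it is the projection to $\mathcal X$ of a $\Pi^0_1$ subset of $\mathcal X\times\mathcal N$. It is $\Sigma^0_1(\alpha)$ (respectively $\Sigma^1_1(\alpha)$) if it is the section $\{x:(\alpha,x)\in R\}$ of a $\Sigma^0_1$ (respectively $\Sigma^1_1$) set $R\subseteq\mathcal N\times\mathcal X$. A function $f:\mathcal X\to\mathcal Y$ is recursive if $\{(x,s):f(x)\in N(\mathcal Y,s)\}\subseteq\mathcal X\times\omega$ is $\Sigma^0_1$. A point $\beta\in\mathcal N$ is recursive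 in $\alpha$ if $\{s\in\omega:\beta\in N(\mathcal N,s)\}$ is $\Sigma^0_1(\alpha)$. For $A\subseteq\mathcal X$, a family $(Q_u)_{u\in\omega^{<\omega}}$ of subsets of $\mathcal X$ is a good Souslin scheme for $A$ if: (a) $A=\{x:(\exists\alpha\in\mathcal N)(\forall n)\ x\in Q_{\alpha\upharpoonright n}\}$; (b) each $Q_u$ is closed; (c) $Q_v\subseteq Q_u$ whenever $v$ extends $u$; (d) $Q_{u^\frown(i)^\frown v}\subseteq Q_{u^\frown(j)^\frown v}$ for all $u,v\in\omega^{<\omega}$ and all $i\le j$. A point $\beta\in\mathcal N$ is a good Souslin code for $A$ if the family $Q_u=\mathrm F^{\mathcal X}((\beta)_{\langle u\rangle})$ is a good Souslin scheme for $A$. **Proposition.** Let $\mathcal X$ be a recursive Polish space. Then for every $\alpha\in\mathcal N$, every $\Sigma^1_1(\alpha)$ set $A\subseteq\mathcal X$ has a good Souslin code $\beta\in\mathcal N$ that is recursive in $\alpha$. In fact there is a recursive function $\mathrm{str}^{\mathcal X}:\mathcal N\to\mathcal N$ such that for every $\alpha\in\mathcal N$ the point $\mathrm{str}^{\mathcal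 X}(\alpha)$ is recursive in $\alpha$ and is a good Souslin code for $\mathrm G_1^{\mathcal X}(\alpha)$. -/

import Mathlib

namespace EDST

/-! ### Coding of finite sequences of naturals -/

/-- `⟨u₀, …, u_{n-1}⟩ = p₀^(u₀+1) ⋯ p_{n-1}^(u_{n-1}+1)`, with `p₀ = 2, p₁ = 3, …` the primes;
the code of the empty sequence is `1`. -/
noncomputable def code (u : List ℕ) : ℕ :=
  ∏ i ∈ Finset.range u.length, Nat.nth Nat.Prime i ^ (u.getD i 0 + 1)

open Classical in
/-- `(s)_i`: the `i`-th entry of the sequence coded by `s`, and `0` if `s` is not a code or if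
`i` is at least the length of the coded sequence. See `entry_code` and `entry_of_not_code`. -/
noncomputable def entry (s i : ℕ) : ℕ :=
  if s ∈ Set.range code then s.factorization (Nat.nth Nat.Prime i) - 1 else 0

theorem factorization_code (u : List ℕ) (i : ℕ) :
    (code u).factorization (Nat.nth Nat.Prime i) =
      if i < u.length then u.getD i 0 + 1 else 0 := by
  unfold code
  rw [Nat.factorization_prod_apply
    (fun j _ => pow_ne_zero _ (Nat.prime_nth_prime j).ne_zero)]
  have h : ∀ j ∈ Finset.range u.length,
      (Nat.nth Nat.Prime j ^ (u.getD j 0 + 1)).factorization (Nat.nth Nat.Prime i) =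
        if i = j then u.getD i 0 + 1 else 0 := by
    intro j _
    rw [Nat.Prime.factorization_pow (Nat.prime_nth_prime j), Finsupp.single_apply]
    have hinj := (Nat.nth_injective Nat.infinite_setOfPred_prime).eq_iff (a := j) (b := i)
    by_cases hij : i = j
    · subst hij; simp
    · have : ¬ Nat.nth Nat.Prime j = Nat.nth Nat.Prime i := fun e => hij (hinj.1 e).symm
      simp [hij, this]
  rw [Finset.sum_congr rfl h, Finset.sum_ite_eq]
  simp

theorem entry_code (u : List ℕ) (i : ℕ) : entry (code u) i = u.getD i 0 := by
  unfold entry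
  rw [if_pos ⟨u, rfl⟩, factorization_code]
  by_cases h : i < u.length
  · simp [h]
  · simp [h]

theorem entry_of_not_code {s : ℕ} (hs : s ∉ Set.range code) (i : ℕ) : entry s i = 0 := by
  unfold entry
  rw [if_neg hs]

/-- The enumeration `q_s = (s)₀ / ((s)₁ + 1)` of the non-negative rationals. -/
noncomputable def rat (s : ℕ) : ℝ := (entry s 0 : ℝ) / ((entry s 1 : ℝ) + 1)

/-! ### Recursive presentations, basic neighborhoods, products -/

/-- A sequence `r` is a recursive presentation of the metric space `X`: it is dense and the
relations `d(r_i, r_j) < q_k` and `d(r_i, r_j) ≤ q_k` are recursive. -/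
structure IsRecursivePresentation {X : Type*} [MetricSpace X] (r : ℕ → X) : Prop where
  dense : DenseRange r
  lt_computable :
    ComputablePred fun p : ℕ × ℕ × ℕ => dist (r p.1) (r p.2.1) < rat p.2.2
  le_computable :
    ComputablePred fun p : ℕ × ℕ × ℕ => dist (r p.1) (r p.2.1) ≤ rat p.2.2

/-- `N(X, s)`: the open ball with center `r_{(s)₀}` and radius `q_{(s)₁}`. -/
def nbhd {X : Type*} [MetricSpace X] (r : ℕ → X) (s : ℕ) : Set X :=
  Metric.ball (r (entry s 0)) (rat (entry s 1))

/-- The presentation `s ↦ (r_{(s)₀}, r'_{(s)₁})` of `X × Y`; the metric of `X × Y` is the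
maximum metric. -/
noncomputable def prodSeq {X Y : Type*} (r : ℕ → X) (r' : ℕ → Y) : ℕ → X × Y :=
  fun s => (r (entry s 0), r' (entry s 1))

/-- The Baire space. -/
abbrev Baire : Type := ℕ → ℕ

/-- The standard complete metric of the Baire space: `d(α, β) = 2⁻ⁿ` for the least `n` with
`α n ≠ β n`, and `d(α, α) = 0`. It induces the product topology. -/
noncomputable instance : MetricSpace Baire := PiNat.metricSpaceNatNat

/-- The standard presentation of the Baire space by the eventually zero sequences
`((s)₀, (s)₁, (s)₂, …)`. -/
noncomputable def baireSeq : ℕ → Baire := fun s n => entry s n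

/-- The standard presentation of `ω`. -/
def natSeq : ℕ → ℕ := id

/-! ### Universal sets -/

/-- The section at `α` of the universal open set: `⋃ n, N(X, α(n))`. -/
def openSet {X : Type*} [MetricSpace X] (r : ℕ → X) (α : Baire) : Set X :=
  {x | ∃ n, x ∈ nbhd r (α n)}

/-- The section at `α` of the universal closed set. -/
def closedSet {X : Type*} [MetricSpace X] (r : ℕ → X) (α : Baire) : Set X :=
  {x | x ∉ openSet r α}

/-- The section at `α` of the universal analytic set: the projection along the Baire space of
the closed subset of `X × Baire` coded by `α`. -/
def analyticSet {X : Type*} [MetricSpace X] (r : ℕ → X) (α : Baire) : Set X :=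
  {x | ∃ γ : Baire, (x, γ) ∈ closedSet (prodSeq r baireSeq) α}

/-! ### Lightface classes and recursive functions

A recursive Polish space is given by a metric together with a recursive presentation `r`. -/

/-- `Σ⁰₁` (semirecursive) sets: unions of a recursive sequence of basic neighborhoods. -/
def IsSigma01 {X : Type*} [MetricSpace X] (r : ℕ → X) (P : Set X) : Prop :=
  ∃ ε : ℕ → ℕ, Computable ε ∧ P = openSet r ε

/-- `Π⁰₁` sets. -/
def IsPi01 {X : Type*} [MetricSpace X] (r : ℕ → X) (P : Set X) : Prop :=
  IsSigma01 r Pᶜ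

/-- `Σ¹₁` sets: projections along the Baire space of `Π⁰₁` sets. -/
def IsSigma11 {X : Type*} [MetricSpace X] (r : ℕ → X) (P : Set X) : Prop :=
  ∃ Q : Set (X × Baire), IsPi01 (prodSeq r baireSeq) Q ∧ P = {x | ∃ γ, (x, γ) ∈ Q}

/-- `Σ⁰₁(α)` sets: sections at `α` of `Σ⁰₁` subsets of `Baire × X`. -/
def IsSigma01In {X : Type*} [MetricSpace X] (r : ℕ → X) (α : Baire) (P : Set X) : Prop :=
  ∃ R : Set (Baire × X), IsSigma01 (prodSeq baireSeq r) R ∧ P = {x | (α, x) ∈ R}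

/-- `Σ¹₁(α)` sets: sections at `α` of `Σ¹₁` subsets of `Baire × X`. -/
def IsSigma11In {X : Type*} [MetricSpace X] (r : ℕ → X) (α : Baire) (P : Set X) : Prop :=
  ∃ R : Set (Baire × X), IsSigma11 (prodSeq baireSeq r) R ∧ P = {x | (α, x) ∈ R}

/-- `f : X → Y` is recursive: the relation `f(x) ∈ N(Y, s)` on `X × ω` is `Σ⁰₁`. -/
def IsRecursiveFun {X Y : Type*} [MetricSpace X] [MetricSpace Y] (r : ℕ → X) (r' : ℕ → Y)
    (f : X → Y) : Prop :=
  IsSigma01 (prodSeq r natSeq) {p : X × ℕ | f p.1 ∈ nbhd r' p.2}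

/-- The point `β` of the Baire space is recursive in `α`: the set of (codes of) basic
neighborhoods of `β` is a `Σ⁰₁(α)` set of naturals. -/
def IsRecursiveIn (β α : Baire) : Prop :=
  IsSigma01In natSeq α {s : ℕ | β ∈ nbhd baireSeq s}

/-! ### Souslin schemes -/

/-- `α ↾ n`. -/
def restrict (α : Baire) (n : ℕ) : List ℕ := (List.range n).map α

/-- The Souslin operation. -/
def souslin {X : Type*} (Q : List ℕ → Set X) : Set X :=
  {x | ∃ α : Baire, ∀ n, x ∈ Q (restrict α n)}

/-- `Q` is a good Souslin scheme for `A`. -/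
structure IsGoodSouslinScheme {X : Type*} [TopologicalSpace X] (A : Set X)
    (Q : List ℕ → Set X) : Prop where
  eq_souslin : A = souslin Q
  closed : ∀ u, IsClosed (Q u)
  regular : ∀ u v, u <+: v → Q v ⊆ Q u
  increasing : ∀ (u v : List ℕ) (i j : ℕ), i ≤ j → Q (u ++ i :: v) ⊆ Q (u ++ j :: v)

/-- `(β)_n = (i ↦ β(⟨n, i⟩))`. -/
noncomputable def column (β : Baire) (n : ℕ) : Baire := fun i => β (code [n, i])

/-- `β` is a good Souslin code for `A`: the scheme whose member at `u` is the closed set with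
code `(β)_{⟨u⟩}` is a good Souslin scheme for `A`. -/
def IsGoodSouslinCode {X : Type*} [MetricSpace X] (r : ℕ → X) (β : Baire) (A : Set X) : Prop :=
  IsGoodSouslinScheme A fun u => closedSet r (column β (code u))

end EDST

/-!
Let `α` code the closed set `C ⊆ X × Baire` whose complement is the union of the neighborhoods
`B(aₙ, qₙ) × B(cₙ, qₙ)`. For a finite sequence `v` let `F_v` be the complement of the union of
those balls `B(aₙ, qₙ)` with `n < |v|` for which the first entries of `v` already ensure that
every extension of `v` lies in `B(cₙ, qₙ)` (`approxSection`). Each `F_v` is closed, `F_v` decreases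
when `v` is extended, and the intersection of the `F_{γ ↾ n}` is the section of `C` at `γ`; hence
the Souslin operation applied to `F` gives the projection of `C` (`souslin_approxSection`).

To get the monotonicity demanded of a good scheme, put `Q_u = ⋃ F_v`, the union over the finitely
many `v` of the length of `u` that are pointwise at most `u`. This does not enlarge the result of
the Souslin operation: if `x` lies in every `Q_{α ↾ n}`, then compactness of the product of the
sets `{0, …, α i}` gives a `γ` with `x` in every `F_{γ ↾ n}` (`isGoodSouslinScheme_below`).

The complement of `Q_u` is a finite intersection of finite unions of balls. By density of the
presentation, it is the union of the basic neighborhoods that pass a formal test of inclusion,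
which compares distances of centers with differences of radii (`exists_admissible_iff`). The test
is decidable by the hypothesis on the presentation and uses only the first `|u|` values of `α`,
so the code `souslinCode r α` of the scheme is computed from `α`, its value at `t` from `α ↾ t`
(`IsFiniteUse`). Such functions are recursive in the topological sense
(`IsFiniteUse.isRecursiveFun`) and closed under composition. The relativized assertion follows by
composing with the function that sends `α` to a code of the section at `α` of a `Π⁰₁` subset of
`(Baire × X) × Baire` (`sectionCode`).

All the coding functions are primitive recursive. For the enumeration of the primes this uses the
bound `pᵢ ≤ 2^(i+1)`, from Bertrand's postulate.
-/

namespace EDST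

/-! ### Primitive recursiveness of the coding of sequences -/

theorem primrecRel_dvd : PrimrecRel fun m n : ℕ => m ∣ n :=
  (Primrec.eq.comp (Primrec.nat_mod.comp Primrec.snd Primrec.fst) (Primrec.const 0)).of_eq
    fun p => (Nat.dvd_iff_mod_eq_zero (m := p.1) (n := p.2)).symm

theorem primrec₂_pow : Primrec₂ fun m n : ℕ => m ^ n :=
  Primrec₂.unpaired'.1 Nat.Primrec.pow

theorem primrecPred_prime : PrimrecPred Nat.Prime := by
  have h : PrimrecRel fun m p : ℕ => ¬ m ∣ p ∨ m = 1 :=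
    (primrecRel_dvd.not).or (Primrec.eq.comp Primrec.fst (Primrec.const 1))
  have h₂ : PrimrecPred fun p : ℕ => ∀ m < p, ¬ m ∣ p ∨ m = 1 :=
    h.forall_lt.comp Primrec.id Primrec.id
  refine ((Primrec.nat_le.comp (Primrec.const 2) Primrec.id).and h₂).of_eq fun p => ?_
  simp only [Nat.prime_def_lt, id, imp_iff_not_or]

theorem primrec_count_prime : Primrec (Nat.count Nat.Prime) := by
  have h : Primrec fun n : ℕ => ((List.range n).filter fun m => decide m.Prime).length :=
    Primrec.list_length.comp ((Primrec.listFilter primrecPred_prime).comp Primrec.list_range)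
  refine h.of_eq fun n => ?_
  rw [Nat.count, List.countP_eq_length_filter]

theorem nth_prime_le_two_pow (i : ℕ) : Nat.nth Nat.Prime i ≤ 2 ^ (i + 1) := by
  induction i with
  | zero => simp
  | succ i ih =>
    obtain ⟨q, hq, hlt, hle⟩ := Nat.exists_prime_lt_and_le_two_mul _
      (Nat.prime_nth_prime i).ne_zero
    have h : i < Nat.count Nat.Prime q := by
      rw [← Nat.nth_count hq] at hlt
      exact (Nat.nth_lt_nth Nat.infinite_setOfPred_prime).1 hlt
    have h₂ : Nat.nth Nat.Prime (i + 1) ≤ q := by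
      rw [← Nat.nth_count hq]
      exact (Nat.nth_le_nth Nat.infinite_setOfPred_prime).2 h
    rw [pow_succ]
    omega

theorem primrec_nth_prime : Primrec (Nat.nth Nat.Prime) := by
  refine Primrec.of_graph ⟨fun i => 2 ^ (i + 1),
    primrec₂_pow.comp (Primrec.const 2) Primrec.succ, nth_prime_le_two_pow⟩ ?_
  refine ((primrecPred_prime.comp Primrec.snd).and
    (Primrec.eq.comp (primrec_count_prime.comp Primrec.snd) Primrec.fst)).of_eq fun p => ?_
  constructor
  · rintro ⟨h₁, h₂⟩
    rw [← h₂, Nat.nth_count h₁]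
  · rintro h
    rw [← h]
    exact ⟨Nat.prime_nth_prime _, Nat.count_nth_of_infinite Nat.infinite_setOfPred_prime _⟩

theorem primrec_code : Primrec code := by
  have h : Primrec fun u : List ℕ => Nat.rec (motive := fun _ => ℕ) 1
      (fun i ih => ih * Nat.nth Nat.Prime i ^ (u.getD i 0 + 1)) u.length := by
    refine Primrec.nat_rec' (h := fun u p => p.2 * Nat.nth Nat.Prime p.1 ^ (u.getD p.1 0 + 1))
      Primrec.list_length (Primrec.const 1) ?_
    exact Primrec.nat_mul.comp (Primrec.snd.comp Primrec.snd)
      (primrec₂_pow.comp (primrec_nth_prime.comp (Primrec.fst.comp Primrec.snd))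
        (Primrec.succ.comp ((Primrec.list_getD 0).comp Primrec.fst
          (Primrec.fst.comp Primrec.snd))))
  refine h.of_eq fun u => ?_
  unfold code
  induction u.length with
  | zero => simp
  | succ n ih => rw [Finset.prod_range_succ, ← ih]

theorem primrec₂_factorization_nth_prime :
    Primrec₂ fun s i : ℕ => s.factorization (Nat.nth Nat.Prime i) := by
  have h : PrimrecRel fun (p : ℕ × ℕ) (k : ℕ) => Nat.nth Nat.Prime p.2 ^ k ∣ p.1 :=
    primrecRel_dvd.comp
      (primrec₂_pow.comp (primrec_nth_prime.comp (Primrec.snd.comp Primrec.fst)) Primrec.snd)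
      (Primrec.fst.comp Primrec.fst)
  refine (Primrec.nat_findGreatest Primrec.fst h).of_eq fun p => ?_
  obtain ⟨s, i⟩ := p
  rcases eq_or_ne s 0 with rfl | hs
  · simp
  · have key := fun k => (Nat.prime_nth_prime i).pow_dvd_iff_le_factorization (k := k) hs
    rw [Nat.findGreatest_eq_iff]
    refine ⟨(Nat.factorization_lt _ hs).le, fun _ => (key _).2 le_rfl, fun n hn _ h => ?_⟩
    exact absurd ((key n).1 h) (by simpa using hn)

/-- The list of the first `n` entries that `s` would have as a code of a sequence. -/
noncomputable def exponents (s n : ℕ) : List ℕ :=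
  (List.range n).map fun i => s.factorization (Nat.nth Nat.Prime i) - 1

theorem primrec₂_exponents : Primrec₂ exponents :=
  Primrec.list_map (Primrec.list_range.comp Primrec.snd)
    (Primrec.pred.comp (primrec₂_factorization_nth_prime.comp
      (Primrec.fst.comp Primrec.fst) Primrec.snd))

theorem exponents_code (u : List ℕ) : exponents (code u) u.length = u := by
  refine List.ext_getElem (by simp [exponents]) fun i h₁ h₂ => ?_
  simp [exponents, factorization_code, h₂]

theorem code_ne_zero (u : List ℕ) : code u ≠ 0 :=
  Finset.prod_ne_zero_iff.2 fun i _ => pow_ne_zero _ (Nat.prime_nth_prime i).ne_zero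

theorem length_lt_code (u : List ℕ) : u.length < code u := by
  refine (Nat.lt_two_pow_self).trans_le ?_
  unfold code
  rw [← Finset.card_range u.length, ← Finset.prod_const, Finset.card_range]
  refine Finset.prod_le_prod' fun i _ => ?_
  exact (Nat.prime_nth_prime i).two_le.trans (Nat.le_self_pow (by omega) _)

theorem entry_le (s i : ℕ) : entry s i ≤ s := by
  unfold entry
  split_ifs with h
  · obtain ⟨u, rfl⟩ := h
    exact (Nat.sub_le _ _).trans (Nat.factorization_lt _ (code_ne_zero u)).le
  · exact Nat.zero_le _

/-- The length of the sequence coded by `s`, and `0` if `s` is not a code. -/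
noncomputable def decodeLength (s : ℕ) : ℕ :=
  Nat.findGreatest (fun n => code (exponents s n) = s) s

/-- The sequence coded by `s`, and the empty sequence if `s` is not a code. -/
noncomputable def decodeSeq (s : ℕ) : List ℕ := exponents s (decodeLength s)

theorem primrec_decodeSeq : Primrec decodeSeq :=
  primrec₂_exponents.comp Primrec.id (Primrec.nat_findGreatest Primrec.id
    (Primrec.eq.comp (primrec_code.comp (primrec₂_exponents.comp Primrec.fst Primrec.snd))
      Primrec.fst))

theorem decodeLength_code (u : List ℕ) : decodeLength (code u) = u.length := by
  refine Nat.findGreatest_eq_iff.2 ⟨(length_lt_code u).le, fun _ => by rw [exponents_code],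
    fun n hn _ h => ?_⟩
  have := congrArg (fun s => s.factorization (Nat.nth Nat.Prime u.length)) h
  simp only [factorization_code, lt_irrefl, if_false] at this
  simp [exponents, hn] at this

theorem decodeSeq_code (u : List ℕ) : decodeSeq (code u) = u := by
  rw [decodeSeq, decodeLength_code, exponents_code]

/-- Membership in the range of `code` is decidable, by decoding and coding again. -/
theorem mem_range_code_iff {s : ℕ} : s ∈ Set.range code ↔ code (decodeSeq s) = s :=
  ⟨by rintro ⟨u, rfl⟩; rw [decodeSeq_code], fun h => ⟨_, h⟩⟩

open Classical in
theorem primrec₂_entry : Primrec₂ entry := by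
  have h : PrimrecPred fun p : ℕ × ℕ => code (decodeSeq p.1) = p.1 :=
    Primrec.eq.comp (primrec_code.comp (primrec_decodeSeq.comp Primrec.fst)) Primrec.fst
  refine (Primrec.ite h (Primrec.pred.comp primrec₂_factorization_nth_prime)
    (Primrec.const 0)).of_eq fun p => ?_
  simp only [entry, mem_range_code_iff, Nat.pred_eq_sub_one]

/-! ### Computable case distinctions and operations on lists -/

theorem computable_list_map {α β σ : Type*} [Primcodable α] [Primcodable β] [Primcodable σ]
    {f : α → List β} {g : α → β → σ} (hf : Computable f) (hg : Computable₂ g) :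
    Computable fun a => (f a).map (g a) := by
  have step : Computable₂ fun (a : α) (p : ℕ × List σ) =>
      p.2 ++ (((f a)[p.1]?).map (g a)).toList := by
    have hidx : Computable fun q : α × ℕ × List σ => (f q.1)[q.2.1]? :=
      Computable.list_getElem?.comp (hf.comp Computable.fst)
        (Computable.fst.comp Computable.snd)
    have hmap : Computable fun q : α × ℕ × List σ => ((f q.1)[q.2.1]?).map (g q.1) :=
      Computable.option_map hidx
        (hg.comp (Computable.fst.comp Computable.fst) Computable.snd)
    exact Computable.list_append.comp (Computable.snd.comp Computable.snd)
      (Primrec.optionToList.to_comp.comp hmap)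
  refine (Computable.nat_rec (Computable.list_length.comp hf) (Computable.const [])
    step).of_eq fun a => ?_
  have key : ∀ n, (Nat.rec [] (fun y IH => IH ++ (((f a)[y]?).map (g a)).toList) n : List σ) =
      ((f a).take n).map (g a) := by
    intro n
    induction n with
    | zero => simp
    | succ n ih =>
      rw [List.take_add_one, List.map_append, ← Option.toList_map]
      exact congrArg (· ++ _) ih
  simpa using key (f a).length

theorem computable_list_any {α : Type*} [Primcodable α] {p : α → Bool} (hp : Computable p) :
    Computable fun l : List α => l.any p := by
  have h : Primrec fun l : List Bool => l.foldr (fun b c => b || c) false :=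
    Primrec.list_foldr Primrec.id (Primrec.const false)
      (Primrec.or.comp (Primrec.fst.comp Primrec.snd) (Primrec.snd.comp Primrec.snd)).to₂
  refine (h.to_comp.comp (computable_list_map Computable.id (hp.comp Computable.snd).to₂)).of_eq
    fun l => ?_
  induction l with
  | nil => rfl
  | cons a l ih => simpa using congrArg (p a || ·) ih

theorem computable_list_all {α : Type*} [Primcodable α] {p : α → Bool} (hp : Computable p) :
    Computable fun l : List α => l.all p :=
  (Primrec.not.to_comp.comp (computable_list_any (Primrec.not.to_comp.comp hp))).of_eq
    fun l => by simp [List.all_eq_not_any_not]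

theorem computable_ite {α : Type*} [Primcodable α] {c : α → Bool} {f g : α → ℕ}
    (hc : Computable c) (hf : Computable f) (hg : Computable g) :
    Computable fun a => if c a then f a else g a :=
  (Computable.cond hc hf hg).of_eq fun a => by cases c a <;> rfl

/-! ### Basic neighborhoods of the Baire space -/

/-- The finite sequence `v` ensures that every point of the Baire space extending it lies in the
ball with center `baireSeq c` and radius `rat q`: for some `k ≤ |v|` with `2⁻ᵏ < rat q`, the
first `k` entries of `v` and of `baireSeq c` agree. The inequality is stated with the numerator
and the denominator of `rat q`. -/
def Ensures (v : List ℕ) (c q : ℕ) : Prop :=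
  ∃ k < v.length + 1, entry q 1 + 1 < entry q 0 * 2 ^ k ∧ ∀ i < k, v.getD i 0 = entry c i

noncomputable instance (v : List ℕ) (c q : ℕ) : Decidable (Ensures v c q) :=
  Classical.propDecidable _

theorem Ensures.mono {v w : List ℕ} {c q : ℕ} (h : v <+: w) : Ensures v c q → Ensures w c q := by
  rintro ⟨k, hk, hq, hv⟩
  refine ⟨k, hk.trans_le (Nat.succ_le_succ h.length_le), hq, fun i hi => ?_⟩
  obtain ⟨t, rfl⟩ := h
  rw [← hv i hi, List.getD_append _ _ _ _ (by omega)]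

theorem primrecRel_forall_lt {α : Type*} [Primcodable α] {R : ℕ → α → Prop}
    (hR : PrimrecRel R) : PrimrecRel fun n a => ∀ i < n, R i a :=
  (hR.forall_mem_list.comp (Primrec.list_range.comp Primrec.fst) Primrec.snd).of_eq (by simp)

theorem primrecRel_exists_lt {α : Type*} [Primcodable α] {R : ℕ → α → Prop}
    (hR : PrimrecRel R) : PrimrecRel fun n a => ∃ i < n, R i a :=
  (hR.exists_mem_list.comp (Primrec.list_range.comp Primrec.fst) Primrec.snd).of_eq (by simp)

theorem primrecPred_ensures :
    PrimrecPred fun p : List ℕ × ℕ × ℕ => Ensures p.1 p.2.1 p.2.2 := by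
  have h₁ : PrimrecRel fun (i : ℕ) (p : List ℕ × ℕ) => p.1.getD i 0 = entry p.2 i :=
    Primrec.eq.comp ((Primrec.list_getD 0).comp (Primrec.fst.comp Primrec.snd) Primrec.fst)
      (primrec₂_entry.comp (Primrec.snd.comp Primrec.snd) Primrec.fst)
  have h₂ : PrimrecRel fun (k : ℕ) (p : List ℕ × ℕ × ℕ) =>
      ∀ i < k, p.1.getD i 0 = entry p.2.1 i :=
    PrimrecRel.comp (R := fun k (p : List ℕ × ℕ) => ∀ i < k, p.1.getD i 0 = entry p.2 i)
      (primrecRel_forall_lt h₁) Primrec.fst (g := fun x : ℕ × List ℕ × ℕ × ℕ => (x.2.1, x.2.2.1))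
      ((Primrec.fst.comp Primrec.snd).pair
        (Primrec.fst.comp (Primrec.snd.comp Primrec.snd)))
  have hq : Primrec fun x : ℕ × List ℕ × ℕ × ℕ => x.2.2.2 :=
    Primrec.snd.comp (Primrec.snd.comp Primrec.snd)
  have h₃ : PrimrecRel fun (k : ℕ) (p : List ℕ × ℕ × ℕ) =>
      entry p.2.2 1 + 1 < entry p.2.2 0 * 2 ^ k :=
    Primrec.nat_lt.comp (Primrec.succ.comp (primrec₂_entry.comp hq (Primrec.const 1)))
      (Primrec.nat_mul.comp (primrec₂_entry.comp hq (Primrec.const 0))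
        (primrec₂_pow.comp (Primrec.const 2) Primrec.fst))
  have h₄ : PrimrecRel fun (k : ℕ) (p : List ℕ × ℕ × ℕ) =>
      entry p.2.2 1 + 1 < entry p.2.2 0 * 2 ^ k ∧ ∀ i < k, p.1.getD i 0 = entry p.2.1 i :=
    h₃.and h₂
  exact PrimrecRel.comp (R := fun n (p : List ℕ × ℕ × ℕ) => ∃ k < n,
    entry p.2.2 1 + 1 < entry p.2.2 0 * 2 ^ k ∧ ∀ i < k, p.1.getD i 0 = entry p.2.1 i)
    (primrecRel_exists_lt h₄) (Primrec.succ.comp (Primrec.list_length.comp Primrec.fst)) Primrec.id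

theorem dist_le_half_pow_iff {β γ : Baire} {n : ℕ} :
    dist β γ ≤ (1 / 2 : ℝ) ^ n ↔ ∀ i < n, β i = γ i :=
  (PiNat.mem_cylinder_iff_dist_le (E := fun _ => ℕ)).symm

/-- The case `β = γ` needs a `k` with `2⁻ᵏ < q`; otherwise `k` is the place of the first
difference. -/
theorem dist_lt_iff {β γ : Baire} {q : ℝ} :
    dist β γ < q ↔ ∃ k, (1 / 2 : ℝ) ^ k < q ∧ ∀ i < k, β i = γ i := by
  constructor
  · intro h
    rcases eq_or_ne β γ with rfl | hne
    · rw [dist_self] at h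
      obtain ⟨k, hk⟩ := exists_pow_lt_of_lt_one h (by norm_num : (1 / 2 : ℝ) < 1)
      exact ⟨k, hk, fun _ _ => rfl⟩
    · have hd : dist β γ = (1 / 2 : ℝ) ^ PiNat.firstDiff (E := fun _ => ℕ) β γ :=
        PiNat.dist_eq_of_ne (E := fun _ => ℕ) hne
      exact ⟨_, hd ▸ h, fun i hi => PiNat.apply_eq_of_lt_firstDiff hi⟩
  · rintro ⟨k, hk, h⟩
    exact (dist_le_half_pow_iff.2 h).trans_lt hk

theorem half_pow_lt_rat_iff {k q : ℕ} :
    (1 / 2 : ℝ) ^ k < rat q ↔ entry q 1 + 1 < entry q 0 * 2 ^ k := by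
  have h : (0 : ℝ) < (entry q 1 : ℝ) + 1 := by positivity
  rw [rat, one_div, inv_pow, lt_div_iff₀ h, inv_mul_lt_iff₀ (by positivity), ← Nat.cast_lt (α := ℝ)]
  push_cast
  rw [mul_comm (2 ^ k : ℝ)]

theorem length_restrict (α : Baire) (n : ℕ) : (restrict α n).length = n := by simp [restrict]

theorem getD_restrict {α : Baire} {n i : ℕ} (h : i < n) : (restrict α n).getD i 0 = α i := by
  simp [restrict, h]

theorem take_restrict {α : Baire} {m n : ℕ} (h : m ≤ n) :
    (restrict α n).take m = restrict α m := by
  simp [restrict, ← List.map_take, List.take_range, h]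

theorem restrict_prefix {α : Baire} {m n : ℕ} (h : m ≤ n) : restrict α m <+: restrict α n := by
  rw [← take_restrict h]
  exact List.take_prefix _ _

theorem restrict_eq_restrict_iff {α β : Baire} {n : ℕ} :
    restrict α n = restrict β n ↔ ∀ i < n, α i = β i := by
  simp [restrict]

theorem restrict_getD (v : List ℕ) : restrict (fun i => v.getD i 0) v.length = v := by
  refine List.ext_getElem (by simp [restrict]) fun i h₁ h₂ => ?_
  simp [restrict, h₂]

/-- A basic neighborhood of the Baire space is the union of the cylinders of the finite sequences
that ensure membership in it. -/
theorem dist_baireSeq_lt_rat_iff {β : Baire} {c q : ℕ} :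
    dist β (baireSeq c) < rat q ↔ ∃ n, Ensures (restrict β n) c q := by
  simp only [dist_lt_iff, half_pow_lt_rat_iff, Ensures, length_restrict, baireSeq]
  constructor
  · rintro ⟨k, hk, h⟩
    exact ⟨k, k, k.lt_succ_self, hk, fun i hi => by rw [getD_restrict hi, h i hi]⟩
  · rintro ⟨n, k, hkn, hk, h⟩
    exact ⟨k, hk, fun i hi => by rw [← h i hi, getD_restrict (by omega)]⟩

/-! ### Monotone Souslin schemes -/

/-- The list of the sequences that have the length of `u` and are pointwise at most `u`. -/
def below (u : List ℕ) : List (List ℕ) :=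
  u.foldr (fun a L => (List.range (a + 1)).flatMap fun x => L.map (x :: ·)) [[]]

theorem mem_below {u v : List ℕ} : v ∈ below u ↔ List.Forall₂ (· ≤ ·) v u := by
  induction u generalizing v with
  | nil => simp [below]
  | cons a u ih =>
    have : below (a :: u) = (List.range (a + 1)).flatMap fun x => (below u).map (x :: ·) := rfl
    rw [this, List.forall₂_cons_right_iff]
    simp only [List.mem_flatMap, List.mem_range, List.mem_map, ih, Nat.lt_succ_iff]
    constructor
    · rintro ⟨x, hx, w, hw, rfl⟩
      exact ⟨x, w, hx, hw, rfl⟩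
    · rintro ⟨x, w, hx, hw, rfl⟩
      exact ⟨x, hx, w, hw, rfl⟩

theorem primrec_below : Primrec below := by
  have h : Primrec₂ fun (_ : List ℕ) (p : ℕ × List (List ℕ)) =>
      (List.range (p.1 + 1)).flatMap fun x => p.2.map (x :: ·) := by
    refine Primrec.list_flatMap (Primrec.list_range.comp (Primrec.succ.comp
      (Primrec.fst.comp Primrec.snd))) ?_
    exact Primrec.list_map (Primrec.snd.comp (Primrec.snd.comp Primrec.fst))
      (Primrec.list_cons.comp (Primrec.snd.comp Primrec.fst) Primrec.snd)
  exact Primrec.list_foldr Primrec.id (Primrec.const [[]]) h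

theorem length_of_mem_below {u v : List ℕ} (h : v ∈ below u) : v.length = u.length :=
  (mem_below.1 h).length_eq

theorem take_mem_below {u v : List ℕ} (h : v ∈ below u) (n : ℕ) :
    v.take n ∈ below (u.take n) :=
  mem_below.2 (List.forall₂_take n (mem_below.1 h))

theorem mem_below_of_le {u v w : List ℕ} {i j : ℕ} (hij : i ≤ j) (h : w ∈ below (u ++ i :: v)) :
    w ∈ below (u ++ j :: v) := by
  rw [mem_below] at h ⊢
  induction u generalizing w with
  | nil =>
    cases h with
    | cons h₁ h₂ => exact .cons (h₁.trans hij) h₂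
  | cons a u ih =>
    cases h with
    | cons h₁ h₂ => exact .cons h₁ (ih h₂)

theorem restrict_mem_below {γ α : Baire} {n : ℕ} :
    restrict γ n ∈ below (restrict α n) ↔ ∀ i < n, γ i ≤ α i := by
  rw [mem_below, restrict, restrict, List.forall₂_map_left_iff, List.forall₂_map_right_iff,
    List.forall₂_same]
  simp

/-- König's lemma for a compact product of finite sets: if for every `n` some sequence below
`α ↾ n` has a property inherited by initial segments, then some point of the Baire space has
initial segments all with the property. -/
theorem exists_forall_restrict {P : List ℕ → Prop} (hP : ∀ u v, u <+: v → P v → P u) {α : Baire}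
    (h : ∀ n, ∃ v ∈ below (restrict α n), P v) : ∃ γ : Baire, ∀ n, P (restrict γ n) := by
  let C : Set Baire := Set.univ.pi fun i => Set.Iic (α i)
  have hC : IsCompact C := isCompact_univ_pi fun i => (Set.finite_Iic (α i)).isCompact
  let K : ℕ → Set Baire := fun n => {γ | P (restrict γ n)}
  have hK : ∀ n, IsClosed (K n) := by
    intro n
    have h₁ : Continuous fun (γ : Baire) (i : Fin n) => γ i := by fun_prop
    have h₂ : K n = (fun (γ : Baire) (i : Fin n) => γ i) ⁻¹'
        {f | P (List.ofFn f)} := by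
      ext γ
      simp only [K, Set.mem_ofPred_eq, Set.mem_preimage]
      rw [show restrict γ n = List.ofFn fun i : Fin n => γ i from
        List.ext_getElem (by simp [restrict]) fun i h₁ h₂ => by simp [restrict]]
    rw [h₂]
    exact (isClosed_discrete _).preimage h₁
  obtain ⟨γ, hγ⟩ := IsCompact.nonempty_iInter_of_sequence_nonempty_isCompact_isClosed
    (fun n => C ∩ K n)
    (fun n γ hγ => ⟨hγ.1, hP _ _ (restrict_prefix n.le_succ) hγ.2⟩)
    (fun n => by
      obtain ⟨v, hv, hPv⟩ := h n
      have hl : v.length = n := by rw [length_of_mem_below hv, length_restrict]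
      have hr : restrict (fun i => v.getD i 0) n = v := by
        conv_lhs => rw [← hl]
        exact restrict_getD v
      refine ⟨fun i => v.getD i 0, fun i _ => ?_, by rwa [← hr] at hPv⟩
      rw [← hr, restrict_mem_below] at hv
      rcases lt_or_ge i n with hi | hi
      · exact hv i hi
      · simp [hl, hi])
    (hC.inter_right (hK 0))
    (fun n => hC.isClosed.inter (hK n))
  exact ⟨γ, fun n => (Set.mem_iInter.1 hγ n).2⟩

/-- Any Souslin scheme of closed sets that is decreasing along extensions yields a good one for
the same set, by taking at `u` the union of its members at the sequences pointwise at most `u`. -/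
theorem isGoodSouslinScheme_below {X : Type*} [TopologicalSpace X] {F : List ℕ → Set X}
    (hF : ∀ u, IsClosed (F u)) (hF' : ∀ u v, u <+: v → F v ⊆ F u) :
    IsGoodSouslinScheme (souslin F) fun u => {x | ∃ v ∈ below u, x ∈ F v} where
  eq_souslin := by
    ext x
    constructor
    · rintro ⟨γ, hγ⟩
      exact ⟨γ, fun n => ⟨_, restrict_mem_below.2 fun _ _ => le_rfl, hγ n⟩⟩
    · rintro ⟨α, hα⟩
      exact exists_forall_restrict (P := fun v => x ∈ F v) (fun u v huv hv => hF' u v huv hv) hα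
  closed u := by
    have : {x | ∃ v ∈ below u, x ∈ F v} = ⋃ v ∈ {v | v ∈ below u}, F v := by
      ext x
      simp
    rw [this]
    exact (List.finite_toSet _).isClosed_biUnion fun v _ => hF v
  regular u v huv x := by
    rintro ⟨w, hw, hx⟩
    refine ⟨w.take u.length, ?_, hF' _ _ (List.take_prefix _ _) hx⟩
    obtain ⟨t, rfl⟩ := huv
    simpa using take_mem_below hw u.length
  increasing u v i j hij x := by
    rintro ⟨w, hw, hx⟩
    exact ⟨w, mem_below_of_le hij hw, hx⟩

/-! ### Codes of pairs and of neighborhoods in products -/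

theorem entry_zero (i : ℕ) : entry 0 i = 0 := Nat.le_zero.1 (entry_le 0 i)

theorem entry_code_pair_zero (a b : ℕ) : entry (code [a, b]) 0 = a := by simp [entry_code]

theorem entry_code_pair_one (a b : ℕ) : entry (code [a, b]) 1 = b := by simp [entry_code]

theorem primrec₂_code_pair : Primrec₂ fun a b : ℕ => code [a, b] :=
  primrec_code.comp (Primrec.list_cons.comp Primrec.fst
    (Primrec.list_cons.comp Primrec.snd (Primrec.const [])))

theorem rat_code_pair (a b : ℕ) : rat (code [a, b]) = a / ((b : ℝ) + 1) := by
  rw [rat, entry_code_pair_zero, entry_code_pair_one]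

theorem nbhd_zero {X : Type*} [MetricSpace X] (r : ℕ → X) : nbhd r 0 = ∅ := by
  simp [nbhd, entry_zero, rat]

theorem mem_nbhd_prodSeq {X Y : Type*} [MetricSpace X] [MetricSpace Y] {r : ℕ → X} {r' : ℕ → Y}
    {p : X × Y} {s : ℕ} : p ∈ nbhd (prodSeq r r') s ↔
      dist p.1 (r (entry (entry s 0) 0)) < rat (entry s 1) ∧
        dist p.2 (r' (entry (entry s 0) 1)) < rat (entry s 1) := by
  rw [nbhd, Metric.mem_ball, Prod.dist_eq, max_lt_iff, prodSeq]

/-! ### Recursive functions on the Baire space -/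

/-- A function on the Baire space whose value at `t` is computed, uniformly in `t`, from the
first `t` values of the argument. -/
def IsFiniteUse (T : Baire → Baire) : Prop :=
  ∃ g : List ℕ → ℕ → ℕ, Computable₂ g ∧ ∀ α t, T α t = g (restrict α t) t

/-- The values at the arguments below `|w|` of the finite-use function given by `g`, computed
from an initial segment `w` of its argument. -/
def approx (g : List ℕ → ℕ → ℕ) (w : List ℕ) : List ℕ :=
  (List.range w.length).map fun i => g (w.take i) i

theorem computable_approx {g : List ℕ → ℕ → ℕ} (hg : Computable₂ g) : Computable (approx g) :=
  computable_list_map (Primrec.list_range.comp Primrec.list_length).to_comp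
    (hg.comp (Primrec.list_take.comp Primrec.snd Primrec.fst).to_comp Computable.snd)

theorem approx_restrict {g : List ℕ → ℕ → ℕ} {T : Baire → Baire}
    (h : ∀ α t, T α t = g (restrict α t) t) (α : Baire) (n : ℕ) :
    approx g (restrict α n) = restrict (T α) n := by
  rw [approx, length_restrict]
  refine List.map_congr_left fun i hi => ?_
  rw [take_restrict (List.mem_range.1 hi).le, h]

theorem IsFiniteUse.comp {S T : Baire → Baire} (hS : IsFiniteUse S) (hT : IsFiniteUse T) :
    IsFiniteUse fun α => S (T α) := by
  obtain ⟨g, hg, h⟩ := hS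
  obtain ⟨g', hg', h'⟩ := hT
  refine ⟨fun w t => g (approx g' w) t,
    hg.comp ((computable_approx hg').comp Computable.fst) Computable.snd, fun α t => ?_⟩
  change S (T α) t = g (approx g' (restrict α t)) t
  rw [h, approx_restrict h']

/-- The code of the basic neighborhood of `Baire × ω` that is the product of the cylinder of `w`
and `{s}`, provided that `w` is nonempty. -/
noncomputable def cylinderCode (w : List ℕ) (s : ℕ) : ℕ :=
  code [code [code w, s], code [2, 2 ^ w.length - 1]]

theorem primrec₂_cylinderCode : Primrec₂ cylinderCode :=
  primrec₂_code_pair.comp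
    (primrec₂_code_pair.comp (primrec_code.comp Primrec.fst) Primrec.snd)
    (primrec₂_code_pair.comp (Primrec.const 2) (Primrec.nat_sub.comp
      (primrec₂_pow.comp (Primrec.const 2) (Primrec.list_length.comp Primrec.fst))
      (Primrec.const 1)))

theorem mem_nbhd_cylinderCode {w : List ℕ} (hw : 0 < w.length) {s : ℕ} {p : Baire × ℕ} :
    p ∈ nbhd (prodSeq baireSeq natSeq) (cylinderCode w s) ↔
      restrict p.1 w.length = w ∧ p.2 = s := by
  obtain ⟨n, hn⟩ := Nat.exists_eq_succ_of_ne_zero hw.ne'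
  -- The radius is small enough to separate the points of `ω`, because `w` is nonempty.
  have hr : rat (code [2, 2 ^ w.length - 1]) = (1 / 2 : ℝ) ^ n := by
    rw [rat_code_pair, Nat.cast_sub Nat.one_le_two_pow, hn]
    push_cast
    rw [sub_add_cancel, pow_succ, one_div, inv_pow]
    field_simp
  have h₁ : dist p.1 (baireSeq (code w)) < (1 / 2 : ℝ) ^ n ↔ restrict p.1 w.length = w := by
    conv_rhs => rhs; rw [← restrict_getD w]
    rw [restrict_eq_restrict_iff, dist_lt_iff]
    simp only [baireSeq, entry_code]
    constructor
    · rintro ⟨k, hk, h⟩ i hi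
      rw [pow_lt_pow_iff_right_of_lt_one₀ (by norm_num) (by norm_num)] at hk
      exact h i (by omega)
    · intro h
      exact ⟨w.length, by
        rw [pow_lt_pow_iff_right_of_lt_one₀ (by norm_num) (by norm_num)]; omega, h⟩
  have h₂ : dist p.2 (natSeq s) < (1 / 2 : ℝ) ^ n ↔ p.2 = s := by
    constructor
    · intro h
      by_contra hne
      have := Nat.pairwise_one_le_dist hne
      have h' : (1 / 2 : ℝ) ^ n ≤ 1 := pow_le_one₀ (by norm_num) (by norm_num)
      exact absurd (this.trans_lt (h.trans_le h')) (lt_irrefl _)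
    · intro h
      rw [h, natSeq, id, dist_self]
      positivity
  rw [mem_nbhd_prodSeq, cylinderCode]
  simp only [entry_code_pair_zero, entry_code_pair_one]
  rw [hr, h₁, h₂]

/-- The code `0` of the empty neighborhood stands in for the neighborhoods that fail the test. -/
theorem isSigma01_of_enumeration {X β : Type*} [MetricSpace X] (r : ℕ → X) [Denumerable β]
    {c : β → Bool} {f : β → ℕ} (hc : Computable c) (hf : Computable f) :
    IsSigma01 r {x | ∃ b, c b = true ∧ x ∈ nbhd r (f b)} := by
  have h : Computable fun b => if c b then f b else 0 :=
    computable_ite hc hf (Computable.const 0)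
  refine ⟨_, h.comp (Computable.ofNat β), ?_⟩
  ext x
  constructor
  · rintro ⟨b, hb, hx⟩
    refine ⟨Encodable.encode b, ?_⟩
    simpa only [Denumerable.ofNat_encode, hb, if_true] using hx
  · rintro ⟨e, he⟩
    simp only at he
    split_ifs at he with hb
    · exact ⟨_, hb, he⟩
    · simp [nbhd_zero] at he

/-- A finite-use function is recursive: `T α` lies in a basic neighborhood if and only if an
initial segment of `α` determines enough values of `T α` to ensure it. -/
theorem IsFiniteUse.isRecursiveFun {T : Baire → Baire} (hT : IsFiniteUse T) :
    IsRecursiveFun baireSeq baireSeq T := by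
  obtain ⟨g, hg, h⟩ := hT
  let c : List ℕ × ℕ → Bool := fun p =>
    decide (0 < p.1.length) && decide (Ensures (approx g p.1) (entry p.2 0) (entry p.2 1))
  have hpos : Computable fun p : List ℕ × ℕ => decide (0 < p.1.length) :=
    (Primrec.nat_lt.comp (Primrec.const 0) (Primrec.list_length.comp Primrec.fst)).decide.to_comp
  have hens : Computable fun p : List ℕ × ℕ × ℕ => decide (Ensures p.1 p.2.1 p.2.2) :=
    primrecPred_ensures.decide.to_comp
  have harg : Computable fun p : List ℕ × ℕ => (approx g p.1, entry p.2 0, entry p.2 1) :=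
    ((computable_approx hg).comp Computable.fst).pair
      ((primrec₂_entry.comp Primrec.snd (Primrec.const 0)).pair
        (primrec₂_entry.comp Primrec.snd (Primrec.const 1))).to_comp
  have hdec : Computable fun p : List ℕ × ℕ =>
      decide (Ensures (approx g p.1) (entry p.2 0) (entry p.2 1)) :=
    Computable.comp (f := fun p : List ℕ × ℕ × ℕ => decide (Ensures p.1 p.2.1 p.2.2))
      (g := fun p : List ℕ × ℕ => (approx g p.1, entry p.2 0, entry p.2 1)) hens harg
  have hc : Computable c := Primrec.and.to_comp.comp hpos hdec
  have hS := isSigma01_of_enumeration (prodSeq baireSeq natSeq) hc primrec₂_cylinderCode.to_comp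
  suffices hset : {p : Baire × ℕ | T p.1 ∈ nbhd baireSeq p.2} = {x | ∃ p : List ℕ × ℕ,
      c p = true ∧ x ∈ nbhd (prodSeq baireSeq natSeq) (cylinderCode p.1 p.2)} by
    rw [IsRecursiveFun, hset]
    exact hS
  have hmem : ∀ w t, c (w, t) = true ↔
      0 < w.length ∧ Ensures (approx g w) (entry t 0) (entry t 1) := by
    intro w t
    simp only [c, Bool.and_eq_true, decide_eq_true_eq]
  clear_value c
  ext ⟨α, s⟩
  simp only [Set.mem_ofPred_eq, nbhd, Metric.mem_ball, dist_baireSeq_lt_rat_iff]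
  constructor
  · rintro ⟨n, hn⟩
    have hl : 0 < (restrict α (n + 1)).length := by simp [length_restrict]
    refine ⟨(restrict α (n + 1), s), (hmem _ _).2 ⟨hl, ?_⟩,
      (mem_nbhd_cylinderCode hl).2 ⟨by rw [length_restrict], rfl⟩⟩
    rw [approx_restrict h]
    exact hn.mono (restrict_prefix n.le_succ)
  · rintro ⟨⟨w, t⟩, hwt, hα⟩
    obtain ⟨hl, hw⟩ := (hmem _ _).1 hwt
    obtain ⟨hαw, hst⟩ := (mem_nbhd_cylinderCode hl).1 hα
    dsimp only at hαw hst
    subst hst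
    rw [← hαw, approx_restrict h] at hw
    exact ⟨_, hw⟩

theorem IsRecursiveFun.isRecursiveIn {T : Baire → Baire} (hT : IsRecursiveFun baireSeq baireSeq T)
    (α : Baire) : IsRecursiveIn (T α) α :=
  ⟨_, hT, rfl⟩

/-! ### Differences of rationals -/

/-- The truncated difference of two rationals, on codes. -/
noncomputable def subRat (a b : ℕ) : ℕ :=
  code [entry a 0 * (entry b 1 + 1) - entry b 0 * (entry a 1 + 1),
    (entry a 1 + 1) * (entry b 1 + 1) - 1]

theorem primrec₂_subRat : Primrec₂ subRat := by
  have h : ∀ i, Primrec fun p : ℕ × ℕ => entry p.1 i := fun i =>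
    primrec₂_entry.comp Primrec.fst (Primrec.const i)
  have h' : ∀ i, Primrec fun p : ℕ × ℕ => entry p.2 i := fun i =>
    primrec₂_entry.comp Primrec.snd (Primrec.const i)
  exact primrec₂_code_pair.comp
    (Primrec.nat_sub.comp (Primrec.nat_mul.comp (h 0) (Primrec.succ.comp (h' 1)))
      (Primrec.nat_mul.comp (h' 0) (Primrec.succ.comp (h 1))))
    (Primrec.nat_sub.comp
      (Primrec.nat_mul.comp (Primrec.succ.comp (h 1)) (Primrec.succ.comp (h' 1)))
      (Primrec.const 1))

theorem lt_rat_subRat_iff {d : ℝ} (hd : 0 ≤ d) {a b : ℕ} :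
    d < rat (subRat a b) ↔ d + rat b < rat a := by
  have ha : (0 : ℝ) < (entry a 1 : ℝ) + 1 := by positivity
  have hb : (0 : ℝ) < (entry b 1 : ℝ) + 1 := by positivity
  have hden : (((entry a 1 + 1) * (entry b 1 + 1) - 1 : ℕ) : ℝ) + 1 =
      ((entry a 1 : ℝ) + 1) * ((entry b 1 : ℝ) + 1) := by
    rw [Nat.cast_sub (Nat.mul_pos (Nat.succ_pos _) (Nat.succ_pos _))]
    push_cast
    ring
  have hsub : rat a - rat b =
      ((entry a 0 : ℝ) * (entry b 1 + 1) - entry b 0 * (entry a 1 + 1)) /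
        (((entry a 1 : ℝ) + 1) * ((entry b 1 : ℝ) + 1)) := by
    rw [rat, rat, div_sub_div _ _ ha.ne' hb.ne', mul_comm ((entry a 1 : ℝ) + 1) (entry b 0 : ℝ)]
  rw [subRat, rat_code_pair, hden, ← lt_sub_iff_add_lt, hsub]
  rcases le_total (entry b 0 * (entry a 1 + 1)) (entry a 0 * (entry b 1 + 1)) with h | h
  · rw [Nat.cast_sub h]
    push_cast
    rfl
  · -- The numerator is truncated to `0`; both sides are false because `d` is nonnegative.
    rw [Nat.sub_eq_zero_of_le h]
    have h' : (entry a 0 : ℝ) * (entry b 1 + 1) ≤ entry b 0 * (entry a 1 + 1) := by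
      exact_mod_cast h
    refine iff_of_false (by simpa using hd) (not_lt.2 (le_trans ?_ hd))
    exact div_nonpos_of_nonpos_of_nonneg (sub_nonpos.2 h') (by positivity)

/-! ### The code of a good Souslin scheme -/

/-- The codes `m` among the first `|v|` entries of `w` such that every extension of `v` lies in
the second factor of the basic neighborhood of `X × Baire` with code `m`. -/
noncomputable def hits (w v : List ℕ) : List ℕ :=
  (w.take v.length).filter fun m => decide (Ensures v (entry (entry m 0) 1) (entry m 1))

theorem primrec₂_hits : Primrec₂ hits := by
  have hm : Primrec fun p : ℕ × List ℕ => (p.2, entry (entry p.1 0) 1, entry p.1 1) :=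
    Primrec.snd.pair ((primrec₂_entry.comp (primrec₂_entry.comp Primrec.fst (Primrec.const 0))
      (Primrec.const 1)).pair (primrec₂_entry.comp Primrec.fst (Primrec.const 1)))
  have h : PrimrecRel fun (m : ℕ) (v : List ℕ) => Ensures v (entry (entry m 0) 1) (entry m 1) :=
    PrimrecPred.comp (p := fun p : List ℕ × ℕ × ℕ => Ensures p.1 p.2.1 p.2.2)
      (f := fun p : ℕ × List ℕ => (p.2, entry (entry p.1 0) 1, entry p.1 1))
      primrecPred_ensures hm
  have ht : Primrec fun p : List ℕ × List ℕ => p.1.take p.2.length :=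
    Primrec.list_take.comp (Primrec.list_length.comp Primrec.snd) Primrec.fst
  exact Primrec₂.comp (f := fun (L v : List ℕ) =>
    L.filter fun m => decide (Ensures v (entry (entry m 0) 1) (entry m 1)))
    (PrimrecRel.listFilter h) ht Primrec.snd

theorem mem_hits_restrict {α γ : Baire} {n m : ℕ} : m ∈ hits (restrict α n) (restrict γ n) ↔
    (∃ i < n, α i = m) ∧ Ensures (restrict γ n) (entry (entry m 0) 1) (entry m 1) := by
  rw [hits, length_restrict, take_restrict le_rfl, List.mem_filter, decide_eq_true_eq]
  simp [restrict]

theorem hits_restrict {α : Baire} {n : ℕ} {v : List ℕ} (h : v.length ≤ n) :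
    hits (restrict α n) v = hits (restrict α v.length) v := by
  rw [hits, hits, take_restrict h, take_restrict le_rfl]

theorem hits_subset {α : Baire} {u v : List ℕ} (h : u <+: v) :
    hits (restrict α u.length) u ⊆ hits (restrict α v.length) v := by
  intro m hm
  rw [hits, take_restrict le_rfl, List.mem_filter, decide_eq_true_eq] at hm ⊢
  exact ⟨(restrict_prefix h.length_le).subset hm.1, hm.2.mono h⟩

variable {X : Type*} [MetricSpace X]

/-- The first factor of the basic neighborhood of `X × Baire` with code `m`. -/
def fstBall (r : ℕ → X) (m : ℕ) : Set X :=
  Metric.ball (r (entry (entry m 0) 0)) (rat (entry m 1))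

theorem mem_nbhd_prodSeq_baireSeq {r : ℕ → X} {x : X} {γ : Baire} {m : ℕ} :
    (x, γ) ∈ nbhd (prodSeq r baireSeq) m ↔
      x ∈ fstBall r m ∧ ∃ n, Ensures (restrict γ n) (entry (entry m 0) 1) (entry m 1) := by
  rw [mem_nbhd_prodSeq, dist_baireSeq_lt_rat_iff, fstBall, Metric.mem_ball]

/-- The closed set of the points that the first `|v|` neighborhoods of `X × Baire` enumerated by
`α` do not separate from all extensions of `v`. -/
def approxSection (r : ℕ → X) (α : Baire) (v : List ℕ) : Set X :=
  {x | ∀ m ∈ hits (restrict α v.length) v, x ∉ fstBall r m}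

theorem isClosed_approxSection (r : ℕ → X) (α : Baire) (v : List ℕ) :
    IsClosed (approxSection r α v) := by
  have : approxSection r α v = ⋂ m ∈ {m | m ∈ hits (restrict α v.length) v}, (fstBall r m)ᶜ := by
    ext x
    simp [approxSection]
  rw [this]
  exact isClosed_biInter fun m _ => Metric.isOpen_ball.isClosed_compl

theorem approxSection_anti (r : ℕ → X) (α : Baire) (u v : List ℕ) (h : u <+: v) :
    approxSection r α v ⊆ approxSection r α u :=
  fun _ hx m hm => hx m (hits_subset h hm)

theorem souslin_approxSection (r : ℕ → X) (α : Baire) :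
    souslin (approxSection r α) = analyticSet r α := by
  ext x
  refine exists_congr fun γ => ?_
  simp only [approxSection, Set.mem_ofPred_eq, length_restrict, closedSet, openSet, not_exists,
    mem_nbhd_prodSeq_baireSeq, mem_hits_restrict]
  constructor
  · rintro h i ⟨hx, n, hn⟩
    refine h (max n (i + 1)) (α i) ⟨⟨i, by omega, rfl⟩, ?_⟩ hx
    exact hn.mono (restrict_prefix (le_max_left _ _))
  · rintro h n m ⟨⟨i, -, rfl⟩, hm⟩ hx
    exact h i ⟨hx, n, hm⟩

/-- The basic neighborhood of `X` with code `s` is inside the first factor of the basic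
neighborhood of `X × Baire` with code `m`, by a comparison of the distance of the centers with the
difference of the radii. -/
def Inside (r : ℕ → X) (s m : ℕ) : Prop :=
  dist (r (entry s 0)) (r (entry (entry m 0) 0)) < rat (subRat (entry m 1) (entry s 1))

noncomputable instance (r : ℕ → X) (s m : ℕ) : Decidable (Inside r s m) :=
  Classical.propDecidable _

theorem Inside.subset {r : ℕ → X} {s m : ℕ} (h : Inside r s m) : nbhd r s ⊆ fstBall r m := by
  rw [Inside, lt_rat_subRat_iff dist_nonneg] at h
  exact Metric.ball_subset_ball' (by linarith)

theorem computable_inside {r : ℕ → X} (hr : IsRecursivePresentation r) :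
    Computable fun p : ℕ × ℕ => decide (Inside r p.1 p.2) := by
  obtain ⟨f, hf, hrf⟩ := ComputablePred.computable_iff.1 hr.lt_computable
  have harg : Primrec fun p : ℕ × ℕ =>
      (entry p.1 0, entry (entry p.2 0) 0, subRat (entry p.2 1) (entry p.1 1)) :=
    (primrec₂_entry.comp Primrec.fst (Primrec.const 0)).pair
      ((primrec₂_entry.comp (primrec₂_entry.comp Primrec.snd (Primrec.const 0))
        (Primrec.const 0)).pair
      (primrec₂_subRat.comp (primrec₂_entry.comp Primrec.snd (Primrec.const 1))
        (primrec₂_entry.comp Primrec.fst (Primrec.const 1))))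
  refine (hf.comp harg.to_comp).of_eq fun p => ?_
  have h := congrFun hrf (entry p.1 0, entry (entry p.2 0) 0, subRat (entry p.2 1) (entry p.1 1))
  rw [Bool.eq_iff_iff, decide_eq_true_eq]
  exact Iff.of_eq h.symm

/-- The basic neighborhood with code `s` is inside the finite intersection of finite unions of
balls that is the complement of the member at `u` of the good Souslin scheme; `w` is an initial
segment, of length at least `|u|`, of the code of the analytic set. -/
noncomputable def admissible (r : ℕ → X) (w u : List ℕ) (s : ℕ) : Bool :=
  (below u).all fun v => (hits w v).any fun m => decide (Inside r s m)

theorem computable_admissible {r : ℕ → X} (hr : IsRecursivePresentation r) :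
    Computable fun p : List ℕ × List ℕ × ℕ => admissible r p.1 p.2.1 p.2.2 := by
  have hpairs : Primrec fun p : List ℕ × List ℕ × ℕ =>
      (below p.2.1).map fun v => (hits p.1 v).map fun m => (p.2.2, m) := by
    refine Primrec.list_map (primrec_below.comp (Primrec.fst.comp Primrec.snd)) ?_
    refine Primrec.list_map (primrec₂_hits.comp (Primrec.fst.comp Primrec.fst) Primrec.snd) ?_
    exact (Primrec.snd.comp (Primrec.snd.comp (Primrec.fst.comp Primrec.fst))).pair Primrec.snd
  refine ((computable_list_all (computable_list_any (computable_inside hr))).comp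
    hpairs.to_comp).of_eq fun p => ?_
  simp [admissible, List.all_map, List.any_map, Function.comp_def]

/-- The code of a good Souslin scheme for the analytic set with code `α`. Its column at `⟨u⟩`
enumerates the basic neighborhoods that are admissible at `u`, with the code `0` of the empty
neighborhood in place of the others. -/
noncomputable def souslinCode (r : ℕ → X) (α : Baire) : Baire := fun t =>
  if admissible r (restrict α t) (decodeSeq (entry t 0)) (entry t 1) then entry t 1 else 0

theorem isFiniteUse_souslinCode {r : ℕ → X} (hr : IsRecursivePresentation r) :
    IsFiniteUse (souslinCode r) := by
  refine ⟨fun w t => if admissible r w (decodeSeq (entry t 0)) (entry t 1) then entry t 1 else 0,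
    ?_, fun α t => rfl⟩
  have hentry : ∀ i, Primrec fun p : List ℕ × ℕ => entry p.2 i := fun i =>
    primrec₂_entry.comp Primrec.snd (Primrec.const i)
  have harg : Primrec fun p : List ℕ × ℕ => (p.1, decodeSeq (entry p.2 0), entry p.2 1) :=
    Primrec.fst.pair ((primrec_decodeSeq.comp (hentry 0)).pair (hentry 1))
  exact computable_ite
    (Computable.comp (f := fun p : List ℕ × List ℕ × ℕ => admissible r p.1 p.2.1 p.2.2)
      (g := fun p : List ℕ × ℕ => (p.1, decodeSeq (entry p.2 0), entry p.2 1))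
      (computable_admissible hr) harg.to_comp)
    (hentry 1).to_comp (Computable.const 0)

theorem mem_openSet_column_souslinCode_iff {r : ℕ → X} (α : Baire) (u : List ℕ) (x : X) :
    x ∈ openSet r (column (souslinCode r α) (code u)) ↔
      ∃ s, admissible r (restrict α u.length) u s ∧ x ∈ nbhd r s := by
  have key : ∀ s, column (souslinCode r α) (code u) s =
      if admissible r (restrict α u.length) u s then s else 0 := by
    intro s
    have hlen : u.length ≤ code [code u, s] := by
      have h := entry_le (code [code u, s]) 0
      rw [entry_code_pair_zero] at h
      exact (length_lt_code u).le.trans h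
    have hadm : admissible r (restrict α (code [code u, s])) u s =
        admissible r (restrict α u.length) u s := by
      rw [admissible, admissible, Bool.eq_iff_iff, List.all_eq_true, List.all_eq_true]
      refine forall₂_congr fun v hv => ?_
      rw [← length_of_mem_below hv, hits_restrict ((length_of_mem_below hv).trans_le hlen)]
    rw [column, souslinCode, entry_code_pair_zero, entry_code_pair_one, decodeSeq_code, hadm]
  refine exists_congr fun s => ?_
  rw [key]
  split_ifs with h
  · simp [h]
  · simp [h, nbhd_zero]

/-- A point of the finite intersection of finite unions of balls has a basic neighborhood inside
it, by density of the presentation. -/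
theorem exists_admissible_iff {r : ℕ → X} (hr : DenseRange r) (w u : List ℕ) (x : X) :
    (∃ s, admissible r w u s ∧ x ∈ nbhd r s) ↔
      ∀ v ∈ below u, ∃ m ∈ hits w v, x ∈ fstBall r m := by
  simp only [admissible, List.all_eq_true, List.any_eq_true, decide_eq_true_eq]
  constructor
  · rintro ⟨s, hs, hx⟩ v hv
    obtain ⟨m, hm, hsm⟩ := hs v hv
    exact ⟨m, hm, hsm.subset hx⟩
  · intro h
    have hev : ∀ v ∈ {v | v ∈ below u}, ∀ᶠ n : ℕ in Filter.atTop, ∃ m ∈ hits w v,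
        dist x (r (entry (entry m 0) 0)) + 2 * (1 / ((n : ℝ) + 1)) < rat (entry m 1) := by
      intro v hv
      obtain ⟨m, hm, hx⟩ := h v hv
      have hlim : Filter.Tendsto (fun n : ℕ =>
          dist x (r (entry (entry m 0) 0)) + 2 * (1 / ((n : ℝ) + 1))) Filter.atTop
          (nhds (dist x (r (entry (entry m 0) 0)))) := by
        simpa using tendsto_const_nhds.add
          ((tendsto_one_div_add_atTop_nhds_zero_nat (𝕜 := ℝ)).const_mul 2)
      filter_upwards [hlim.eventually_lt_const hx] with n hn
      exact ⟨m, hm, hn⟩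
    obtain ⟨n, hn⟩ := ((Filter.eventually_all_finite (List.finite_toSet (below u))).2 hev).exists
    obtain ⟨j, hj⟩ := hr.exists_dist_lt x (Nat.one_div_pos_of_nat (α := ℝ) (n := n))
    have hrat : rat (code [1, n]) = 1 / ((n : ℝ) + 1) := by rw [rat_code_pair, Nat.cast_one]
    refine ⟨code [j, code [1, n]], fun v hv => ?_, ?_⟩
    · obtain ⟨m, hm, hlt⟩ := hn v hv
      refine ⟨m, hm, ?_⟩
      rw [Inside, lt_rat_subRat_iff dist_nonneg, entry_code_pair_zero, entry_code_pair_one, hrat]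
      have htri := dist_triangle_left (r j) (r (entry (entry m 0) 0)) x
      linarith
    · rw [nbhd, entry_code_pair_zero, entry_code_pair_one, hrat]
      exact hj

theorem isGoodSouslinCode_souslinCode {r : ℕ → X} (hr : DenseRange r) (α : Baire) :
    IsGoodSouslinCode r (souslinCode r α) (analyticSet r α) := by
  have h : (fun u => closedSet r (column (souslinCode r α) (code u))) =
      fun u => {x | ∃ v ∈ below u, x ∈ approxSection r α v} := by
    funext u
    ext x
    rw [closedSet, Set.mem_ofPred_eq, mem_openSet_column_souslinCode_iff,
      exists_admissible_iff hr, Set.mem_ofPred_eq]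
    push Not
    refine exists_congr fun v => and_congr_right fun hv => ?_
    rw [← length_of_mem_below hv]
    rfl
  rw [IsGoodSouslinCode, h, ← souslin_approxSection]
  exact isGoodSouslinScheme_below (isClosed_approxSection r α) (approxSection_anti r α)

/-! ### Sections of lightface analytic sets -/

/-- The code of the section at `α` of the open subset of `(Baire × X) × Baire` enumerated by `ε`:
a neighborhood enumerated by `ε` contributes the product of its last two factors once an initial
segment of `α` ensures that `α` lies in its first factor. -/
noncomputable def sectionCode (ε : ℕ → ℕ) (α : Baire) : Baire := fun t =>
  if Ensures (restrict α (entry t 1)) (entry (entry (entry (ε (entry t 0)) 0) 0) 0)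
      (entry (ε (entry t 0)) 1) then
    code [code [entry (entry (entry (ε (entry t 0)) 0) 0) 1, entry (entry (ε (entry t 0)) 0) 1],
      entry (ε (entry t 0)) 1]
  else 0

theorem isFiniteUse_sectionCode {ε : ℕ → ℕ} (hε : Computable ε) :
    IsFiniteUse (sectionCode ε) := by
  let P : List ℕ × ℕ → ℕ × List ℕ := fun p => (ε (entry p.2 0), p.1.take (entry p.2 1))
  have hP : Computable P :=
    (hε.comp (primrec₂_entry.comp Primrec.snd (Primrec.const 0)).to_comp).pair
      (Primrec.list_take.comp (primrec₂_entry.comp Primrec.snd (Primrec.const 1))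
        Primrec.fst).to_comp
  have hm : ∀ i, Primrec fun p : ℕ × List ℕ => entry p.1 i := fun i =>
    primrec₂_entry.comp Primrec.fst (Primrec.const i)
  have hc : ∀ i, Primrec fun p : ℕ × List ℕ => entry (entry p.1 0) i := fun i =>
    primrec₂_entry.comp (hm 0) (Primrec.const i)
  have hcc : ∀ i, Primrec fun p : ℕ × List ℕ => entry (entry (entry p.1 0) 0) i := fun i =>
    primrec₂_entry.comp (hc 0) (Primrec.const i)
  have harg : Primrec fun p : ℕ × List ℕ => (p.2, entry (entry (entry p.1 0) 0) 0, entry p.1 1) :=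
    Primrec.snd.pair ((hcc 0).pair (hm 1))
  have hdec : Primrec fun p : ℕ × List ℕ =>
      decide (Ensures p.2 (entry (entry (entry p.1 0) 0) 0) (entry p.1 1)) :=
    Primrec.comp (f := fun p : List ℕ × ℕ × ℕ => decide (Ensures p.1 p.2.1 p.2.2))
      (g := fun p : ℕ × List ℕ => (p.2, entry (entry (entry p.1 0) 0) 0, entry p.1 1))
      primrecPred_ensures.decide harg
  have hcode : Primrec fun p : ℕ × List ℕ =>
      code [code [entry (entry (entry p.1 0) 0) 1, entry (entry p.1 0) 1], entry p.1 1] :=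
    primrec₂_code_pair.comp (primrec₂_code_pair.comp (hcc 1) (hc 1)) (hm 1)
  have hG : Computable fun p : ℕ × List ℕ =>
      if decide (Ensures p.2 (entry (entry (entry p.1 0) 0) 0) (entry p.1 1)) then
        code [code [entry (entry (entry p.1 0) 0) 1, entry (entry p.1 0) 1], entry p.1 1]
      else 0 :=
    computable_ite hdec.to_comp hcode.to_comp (Computable.const 0)
  refine ⟨_, (hG.comp hP).to₂, fun α t => ?_⟩
  simp only [P, sectionCode, decide_eq_true_eq]
  rw [take_restrict (entry_le t 1)]

theorem mem_openSet_sectionCode_iff {r : ℕ → X} {ε : ℕ → ℕ} {α γ : Baire} {x : X} :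
    (x, γ) ∈ openSet (prodSeq r baireSeq) (sectionCode ε α) ↔
      ((α, x), γ) ∈ openSet (prodSeq (prodSeq baireSeq r) baireSeq) ε := by
  constructor
  · rintro ⟨t, ht⟩
    unfold sectionCode at ht
    split_ifs at ht with h
    · simp only [mem_nbhd_prodSeq, entry_code_pair_zero, entry_code_pair_one] at ht
      refine ⟨entry t 0, mem_nbhd_prodSeq.2 ⟨?_, ht.2⟩⟩
      rw [Prod.dist_eq]
      exact max_lt (dist_baireSeq_lt_rat_iff.2 ⟨_, h⟩) ht.1
    · simp [nbhd_zero] at ht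
  · rintro ⟨n, hn⟩
    rw [mem_nbhd_prodSeq, Prod.dist_eq, max_lt_iff] at hn
    obtain ⟨k, hk⟩ := dist_baireSeq_lt_rat_iff.1 hn.1.1
    refine ⟨code [n, k], ?_⟩
    simp only [prodSeq] at hk hn
    simp only [sectionCode, entry_code_pair_zero, entry_code_pair_one]
    rw [if_pos hk]
    simp only [mem_nbhd_prodSeq, entry_code_pair_zero, entry_code_pair_one]
    exact ⟨hn.1.2, hn.2⟩

/-- A `Σ¹₁(α)` set has a code as an analytic set that is computed from `α`. -/
theorem IsSigma11In.exists_analyticSet_eq {r : ℕ → X} {α : Baire} {A : Set X}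
    (hA : IsSigma11In r α A) : ∃ T, IsFiniteUse T ∧ A = analyticSet r (T α) := by
  obtain ⟨R, ⟨Q, ⟨ε, hε, hQ⟩, rfl⟩, rfl⟩ := hA
  refine ⟨sectionCode ε, isFiniteUse_sectionCode hε, ?_⟩
  ext x
  refine exists_congr fun γ => ?_
  rw [closedSet, Set.mem_ofPred_eq, mem_openSet_sectionCode_iff, ← hQ, Set.mem_compl_iff, not_not]

end EDST

theorem proposition3p3 {X : Type*} [MetricSpace X] [CompleteSpace X] (r : ℕ → X)
    (hr : EDST.IsRecursivePresentation r) :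
    (∀ (α : EDST.Baire) (A : Set X), EDST.IsSigma11In r α A →
      ∃ β : EDST.Baire, EDST.IsRecursiveIn β α ∧ EDST.IsGoodSouslinCode r β A) ∧
    (∃ str : EDST.Baire → EDST.Baire,
      EDST.IsRecursiveFun EDST.baireSeq EDST.baireSeq str ∧
      ∀ α : EDST.Baire, EDST.IsRecursiveIn (str α) α ∧
        EDST.IsGoodSouslinCode r (str α) (EDST.analyticSet r α)) := by
  have hstr := EDST.isFiniteUse_souslinCode hr
  refine ⟨fun α A hA => ?_, EDST.souslinCode r, hstr.isRecursiveFun, fun α =>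
    ⟨hstr.isRecursiveFun.isRecursiveIn α, EDST.isGoodSouslinCode_souslinCode hr.dense α⟩⟩
  obtain ⟨T, hT, rfl⟩ := hA.exists_analyticSet_eq
  exact ⟨EDST.souslinCode r (T α), (hstr.comp hT).isRecursiveFun.isRecursiveIn α,
    EDST.isGoodSouslinCode_souslinCode hr.dense (T α)⟩
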